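/- All groups are finite, all representations are over $\mathbb{C}$ and finite-dimensional of positive degree. Let $G$ be a finite group and let $M(G)=\mathrm{H}^2(G,\mathbb{C}^\times)$ (trivial action) be its Schur multiplier. A projective representation of $G$ is a map $\rho:G\to \mathrm{GL}(V)$ with $\rho(1)=I_V$ for which there is $\alpha:G\times G\to\mathbb{C}^\times$ with $\rho(g)\rho(h)=\alpha(g,h)\rho(gh)$ for all $g,h\in G$. It is faithful if $g=1$ is the only $g\in G$ for which $\rho(g)$ is a scalar multiple of $I_V$, and irreducible if $V\neq 0$ and $0$ and $V$ are the only subspaces invariant under all $\rho(g)$. Let $\tau(G)$ be the minimal degree of a faithful projective representation of $G$, and let $\tau_{irr}(G)$ be the minimal degree of a faithful irreducible projective representation of $G$; we say that $\tau_{irr}(G)$ exists if there is such a representation. For a group $H$ let $\delta(H)$ be the minimal degree of a faithful (that is, injective) ordinary representation of $H$, and let $\delta_{irr}(H)$ be the minimal degree of a faithful irreducible ordinary representation of $H$; again $\delta_{irr}(H)$ exists if there is such a representation. A covering of $G$, written $A.G$, is a finite group $A.G$ together with a central extension $1\to A\to A.G\to G\to 1$ such that $A$ is contained in the commutator subgroup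 $(A.G)'$ and $A$ is isomorphic to a subgroup of $M(G)$. Theorem. Let $B_G$ be the collection of all coverings $A.G$ of $G$ such that $A\cong Z(A.G)$ and $\delta_{irr}(A.G)$ exists. Then $\tau_{irr}(G)$ exists if and only if $B_G\neq\emptyset$, and in that case $$\tau_{irr}(G)=\min\{\delta_{irr}(A.G) : A.G\in B_G\}.$$ Furthermore $\tau(G)$ and the minimum below exist, and $$\tau(G)\ \ge\ \min\{\delta(A.G) : A.G \text{ a covering of } G\}.$$ -/

import Mathlib

universe u v

/-- The group `Z²(G, ℂˣ)` of `2`-cocycles of `G` with values in the trivial `G`-module `ℂˣ`. -/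
def schurCocycles (G : Type u) [Group G] : Subgroup (G → G → ℂˣ) where
  carrier := {α | ∀ x y z : G, α x y * α (x * y) z = α y z * α x (y * z)}
  mul_mem' := by
    intro α β hα hβ x y z
    have h1 := hα x y z
    have h2 := hβ x y z
    simp only [Pi.mul_apply]
    rw [mul_mul_mul_comm, h1, h2, mul_mul_mul_comm]
  one_mem' := by
    intro x y z
    simp
  inv_mem' := by
    intro α hα x y z
    have h1 := hα x y z
    simp only [Pi.inv_apply]
    rw [← mul_inv, ← mul_inv, h1]

/-- The coboundary map `f ↦ ((x, y) ↦ f(x) f(y) f(xy)⁻¹)` on functions `G → ℂˣ`. -/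
def schurCoboundaryMap (G : Type u) [Group G] : (G → ℂˣ) →* (G → G → ℂˣ) where
  toFun f := fun x y => f x * f y * (f (x * y))⁻¹
  map_one' := by
    funext x y
    simp
  map_mul' := by
    intro f g
    funext x y
    simp only [Pi.mul_apply, mul_inv]
    rw [mul_mul_mul_comm (f x), mul_mul_mul_comm]

/-- The Schur multiplier `M(G) = H²(G, ℂˣ)`: cocycles modulo coboundaries. -/
abbrev SchurMultiplier (G : Type u) [Group G] : Type u :=
  schurCocycles G ⧸ (schurCoboundaryMap G).range.subgroupOf (schurCocycles G)

/-- `ρ : G → GL(V)` is a projective representation: `ρ(1) = 1` and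
`ρ(g) ρ(h) = α(g, h) ρ(gh)` for some `α : G × G → ℂˣ`. -/
def IsProjectiveRep {G : Type u} [Group G] {V : Type v} [AddCommGroup V] [Module ℂ V]
    (ρ : G → LinearMap.GeneralLinearGroup ℂ V) : Prop :=
  ρ 1 = 1 ∧ ∃ α : G → G → ℂˣ, ∀ g h : G,
    (ρ g : Module.End ℂ V) * (ρ h : Module.End ℂ V)
      = (α g h : ℂ) • (ρ (g * h) : Module.End ℂ V)

/-- Faithfulness as a projective representation: only `1 ∈ G` acts as a scalar. -/
def IsProjectivelyFaithful {G : Type u} [Group G] {V : Type v} [AddCommGroup V] [Module ℂ V]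
    (ρ : G → LinearMap.GeneralLinearGroup ℂ V) : Prop :=
  ∀ g : G, (∃ c : ℂˣ, (ρ g : Module.End ℂ V) = (c : ℂ) • (1 : Module.End ℂ V)) → g = 1

/-- Irreducibility of a projective representation: `V ≠ 0` and the only invariant
subspaces are `0` and `V`. -/
def IsProjectivelyIrreducible {G : Type u} {V : Type v} [AddCommGroup V] [Module ℂ V]
    (ρ : G → LinearMap.GeneralLinearGroup ℂ V) : Prop :=
  Nontrivial V ∧ ∀ W : Submodule ℂ V,
    (∀ g : G, ∀ w ∈ W, (ρ g : Module.End ℂ V) w ∈ W) → W = ⊥ ∨ W = ⊤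

/-- `n = τ(G)`: the least positive degree of a faithful projective representation of `G`. -/
def IsProjectiveEmbeddingDegree (G : Type u) [Group G] (n : ℕ) : Prop :=
  IsLeast {d : ℕ | 0 < d ∧ ∃ ρ : G → LinearMap.GeneralLinearGroup ℂ (Fin d → ℂ),
    IsProjectiveRep ρ ∧ IsProjectivelyFaithful ρ} n

/-- `n = τ_irr(G)`: the least degree of a faithful irreducible projective representation
of `G`. (`τ_irr(G)` exists if some `n` has this property.) -/
def IsIrrProjectiveEmbeddingDegree (G : Type u) [Group G] (n : ℕ) : Prop :=
  IsLeast {d : ℕ | 0 < d ∧ ∃ ρ : G → LinearMap.GeneralLinearGroup ℂ (Fin d → ℂ),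
    IsProjectiveRep ρ ∧ IsProjectivelyFaithful ρ ∧ IsProjectivelyIrreducible ρ} n

/-- `n = δ(H)`: the least positive degree of a faithful ordinary representation of `H`. -/
def IsEmbeddingDegree (H : Type u) [Group H] (n : ℕ) : Prop :=
  IsLeast {d : ℕ | 0 < d ∧ ∃ ρ : Representation ℂ H (Fin d → ℂ), Function.Injective ρ} n

/-- `n = δ_irr(H)`: the least degree of a faithful irreducible ordinary representation
of `H`. (`δ_irr(H)` exists if some `n` has this property.) -/
def IsIrrEmbeddingDegree (H : Type u) [Group H] (n : ℕ) : Prop :=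
  IsLeast {d : ℕ | 0 < d ∧ ∃ ρ : Representation ℂ H (Fin d → ℂ),
    Function.Injective ρ ∧ ρ.IsIrreducible} n

/-- A covering `A.G` of `G`: a finite group `E = A.G` in a central extension
`1 → A → E → G → 1` (with `A` the kernel of `proj`) such that `A` lies in the commutator
subgroup of `E` and is isomorphic to a subgroup of the Schur multiplier `M(G)`. -/
structure GroupCovering (G : Type u) [Group G] where
  /-- the group `A.G` -/
  E : Type u
  [group : Group E]
  [finite : Finite E]
  /-- the projection `A.G → G` -/
  proj : E →* G
  proj_surjective : Function.Surjective proj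
  ker_le_center : proj.ker ≤ Subgroup.center E
  ker_le_commutator : proj.ker ≤ commutator E
  ker_embeds : ∃ i : proj.ker →* SchurMultiplier G, Function.Injective i

attribute [instance] GroupCovering.group GroupCovering.finite

/-- `B_G`: the coverings `A.G` of `G` with `A ≅ Z(A.G)` such that `δ_irr(A.G)` exists. -/
def irrCoverings (G : Type u) [Group G] : Set (GroupCovering G) :=
  {C | Nonempty (C.proj.ker ≃* Subgroup.center C.E) ∧ ∃ d : ℕ, IsIrrEmbeddingDegree C.E d}

/-! The factor set α of a projective representation ρ has a class of finite order n, so rescaling ρ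
makes the values of α n-th roots of unity. The pairs (aρ(g), g) with aⁿ = 1 then form a finite
central extension of G by μₙ, and the first coordinate is an ordinary representation of the same
degree (`exists_covering_of_factorSet`). Taking n to be the exact order puts μₙ in the commutator
subgroup: a linear character restricts to μₙ as a k-th power map and makes αᵏ a coboundary, so n ∣ k
and the restriction is trivial.

If ρ is irreducible, Schur's lemma makes the center of the extension scalar, so the kernel is the
full center. Conversely, when the kernel is the center, a faithful irreducible representation
descends along a section. Without irreducibility the kernel need not act by scalars, so lifting
gives only an inequality. -/

section Cocycles

variable {G : Type u} [Group G]

/-- A power of the class of a cocycle is trivial iff that power of the cocycle is a coboundary. -/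
theorem schurClass_zpow_eq_one_iff (α : schurCocycles G) (k : ℤ) :
    (QuotientGroup.mk α : SchurMultiplier G) ^ k = 1 ↔
      ∃ f : G → ℂˣ, ∀ g h, α.1 g h ^ k = f g * f h * (f (g * h))⁻¹ := by
  rw [← QuotientGroup.mk_zpow, QuotientGroup.eq_one_iff, Subgroup.mem_subgroupOf]
  constructor
  · rintro ⟨f, hf⟩
    exact ⟨f, fun g h => (congrFun (congrFun hf g) h).symm⟩
  · rintro ⟨f, hf⟩
    exact ⟨f, funext fun g => funext fun h => (hf g h).symm⟩

theorem schurClass_pow_eq_one_iff (α : schurCocycles G) (k : ℕ) :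
    (QuotientGroup.mk α : SchurMultiplier G) ^ k = 1 ↔
      ∃ f : G → ℂˣ, ∀ g h, α.1 g h ^ k = f g * f h * (f (g * h))⁻¹ := by
  simpa using schurClass_zpow_eq_one_iff α k

/-- The Schur multiplier is annihilated by the order of the group. -/
theorem schurClass_pow_card_eq_one [Finite G] (α : schurCocycles G) :
    (QuotientGroup.mk α : SchurMultiplier G) ^ Nat.card G = 1 := by
  have := Fintype.ofFinite G
  rw [schurClass_pow_eq_one_iff]
  -- Multiply the cocycle identity over its third argument; z ↦ hz permutes G.
  refine ⟨fun x => ∏ z, α.1 x z, fun g h => ?_⟩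
  have key : ∏ z, (α.1 g h * α.1 (g * h) z) = ∏ z, (α.1 h z * α.1 g (h * z)) :=
    Finset.prod_congr rfl fun z _ => α.2 g h z
  rw [Finset.prod_mul_distrib, Finset.prod_mul_distrib, Finset.prod_const, Finset.card_univ,
    Fintype.prod_equiv (Equiv.mulLeft h) (fun z => α.1 g (h * z)) (fun z => α.1 g z)
      (fun _ => rfl)] at key
  rw [Nat.card_eq_fintype_card, eq_mul_inv_iff_mul_eq, key, mul_comm]

theorem Complex.exists_units_pow_eq (n : ℕ) (hn : 0 < n) (c : ℂˣ) : ∃ b : ℂˣ, b ^ n = c := by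
  obtain ⟨z, hz⟩ := IsAlgClosed.exists_pow_nat_eq (c : ℂ) hn
  have hz0 : z ≠ 0 := by
    rintro rfl
    exact c.ne_zero (by rw [← hz, zero_pow hn.ne'])
  exact ⟨Units.mk0 z hz0, Units.ext (by simpa using hz)⟩

/-- Every cocycle is cohomologous to one whose values are roots of unity of exponent the order
of its class. -/
theorem exists_cohomologous_pow_eq_one (α : schurCocycles G) (n : ℕ) (hn : 0 < n)
    (h : (QuotientGroup.mk α : SchurMultiplier G) ^ n = 1) :
    ∃ (f : G → ℂˣ) (β : schurCocycles G),
      (QuotientGroup.mk β : SchurMultiplier G) = QuotientGroup.mk α ∧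
      (∀ x y, β.1 x y = f x * f y * (f (x * y))⁻¹ * α.1 x y) ∧ ∀ x y, β.1 x y ^ n = 1 := by
  obtain ⟨c, hc⟩ := (schurClass_pow_eq_one_iff α n).1 h
  -- The n-th power of the coboundary of f cancels αⁿ.
  choose f hf using fun g => Complex.exists_units_pow_eq n hn (c g)⁻¹
  have hcob : schurCoboundaryMap G f ∈ schurCocycles G := by
    intro x y z
    simp only [schurCoboundaryMap, MonoidHom.coe_mk, OneHom.coe_mk, mul_assoc]
    simp only [mul_left_comm]
    rw [mul_inv_cancel_left, mul_inv_cancel_left]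
  refine ⟨f, ⟨_, hcob⟩ * α, ?_, fun x y => rfl, fun x y => ?_⟩
  · rw [eq_comm, QuotientGroup.eq, mul_comm, mul_inv_cancel_right, Subgroup.mem_subgroupOf]
    exact ⟨f, rfl⟩
  · change (f x * f y * (f (x * y))⁻¹ * α.1 x y) ^ n = 1
    rw [mul_pow, hc, mul_pow, mul_pow, inv_pow, hf, hf, hf, inv_inv]
    rw [← mul_inv, mul_right_comm, mul_assoc, inv_mul_cancel_right, inv_mul_cancel]

end Cocycles

/-! ### The central extension attached to a factor set -/

section Extension

variable {G : Type u} [Group G] {Γ : Type} [Group Γ] {z : ℂˣ →* Γ} {σ : G → Γ}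
  {β : schurCocycles G} {n : ℕ}

/-- A family multiplicative up to central scalars has a cocycle as factor set. -/
theorem factorSet_mem_schurCocycles {α : G → G → ℂˣ} (hz : Function.Injective z)
    (hc : ∀ a x, z a * x = x * z a) (hσ : ∀ g h, σ g * σ h = z (α g h) * σ (g * h)) :
    α ∈ schurCocycles G := by
  intro x y w
  apply hz
  have h1 : σ x * σ y * σ w = z (α x y * α (x * y) w) * σ (x * y * w) := by
    rw [hσ, mul_assoc, hσ, map_mul, mul_assoc (z _)]
  have h2 : σ x * σ y * σ w = z (α y w * α x (y * w)) * σ (x * y * w) := by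
    rw [mul_assoc, hσ, ← mul_assoc, ← hc, mul_assoc, hσ, map_mul, mul_assoc, mul_assoc x]
  exact mul_right_cancel (h1.symm.trans h2)

/-- The group of all pairs `(a σ(g), g)` with `a` an `n`-th root of unity. -/
def scalarExtension (hc : ∀ a x, z a * x = x * z a)
    (hσ : ∀ g h, σ g * σ h = z (β.1 g h) * σ (g * h)) (hn : ∀ g h, β.1 g h ^ n = 1) :
    Subgroup (Γ × G) where
  carrier := {p | ∃ a : ℂˣ, a ^ n = 1 ∧ p.1 = z a * σ p.2}
  mul_mem' := by
    rintro p q ⟨a, ha, hp⟩ ⟨b, hb, hq⟩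
    refine ⟨a * b * β.1 p.2 q.2, by rw [mul_pow, mul_pow, ha, hb, hn, one_mul, one_mul], ?_⟩
    rw [Prod.fst_mul, Prod.snd_mul, hp, hq, map_mul, map_mul, mul_assoc (z a * z b), ← hσ,
      mul_assoc, ← mul_assoc (σ p.2), ← hc b]
    simp only [mul_assoc]
  one_mem' := by
    -- β is not normalized: σ 1 = z (β 1 1), which need not be 1.
    refine ⟨(β.1 1 1)⁻¹, by rw [inv_pow, hn, inv_one], ?_⟩
    have h := hσ 1 1
    rw [one_mul] at h
    rw [Prod.fst_one, Prod.snd_one, mul_right_cancel h, map_inv, inv_mul_cancel]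
  inv_mem' := by
    rintro p ⟨a, ha, hp⟩
    refine ⟨a⁻¹ * (β.1 p.2 p.2⁻¹)⁻¹ * (β.1 1 1)⁻¹,
      by simp only [mul_pow, inv_pow, ha, hn, inv_one, mul_one], ?_⟩
    have h := hσ 1 1
    rw [one_mul] at h
    have h1 := hσ p.2 p.2⁻¹
    rw [mul_inv_cancel, mul_right_cancel h, ← map_mul] at h1
    have h2 : σ p.2⁻¹ = (σ p.2)⁻¹ * z (β.1 p.2 p.2⁻¹ * β.1 1 1) := by rw [← h1]; group
    rw [Prod.fst_inv, Prod.snd_inv, hp, h2, mul_inv_rev, ← mul_assoc, hc, mul_assoc, mul_assoc,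
      ← map_inv, ← map_mul, mul_assoc a⁻¹, ← mul_inv, inv_mul_cancel, mul_one]

/-- A projective family on a finite group lifts to a covering whose kernel is cyclic of order the
order of its cohomology class. -/
theorem exists_covering_of_factorSet [Finite G] (hz : Function.Injective z)
    (hc : ∀ a x, z a * x = x * z a) {ρ : G → Γ} {α : G → G → ℂˣ}
    (hρ : ∀ g h, ρ g * ρ h = z (α g h) * ρ (g * h)) :
    ∃ (C : GroupCovering G) (φ : C.E →* Γ), (∀ e, ∃ a, φ e = z a * ρ (C.proj e)) ∧
      ∀ e, φ e = 1 → C.proj e = 1 → e = 1 := by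
  have hα : α ∈ schurCocycles G := factorSet_mem_schurCocycles hz hc hρ
  have hfin : IsOfFinOrder (QuotientGroup.mk (⟨α, hα⟩ : schurCocycles G) : SchurMultiplier G) :=
    isOfFinOrder_iff_pow_eq_one.2 ⟨_, Nat.card_pos, schurClass_pow_card_eq_one _⟩
  obtain ⟨n, hn⟩ : ∃ n, n = orderOf
    (QuotientGroup.mk (⟨α, hα⟩ : schurCocycles G) : SchurMultiplier G) := ⟨_, rfl⟩
  have hn0 : 0 < n := hn ▸ hfin.orderOf_pos
  have : NeZero n := ⟨hn0.ne'⟩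
  obtain ⟨f, β, hβα, hβ, hβn⟩ := exists_cohomologous_pow_eq_one ⟨α, hα⟩ n hn0
    (hn ▸ pow_orderOf_eq_one _)
  rw [← hβα] at hn
  have hσ : ∀ g h, z (f g) * ρ g * (z (f h) * ρ h) = z (β.1 g h) * (z (f (g * h)) * ρ (g * h)) := by
    intro g h
    rw [hβ, mul_assoc, ← mul_assoc (ρ g), ← hc, mul_assoc (z (f h)), hρ, ← mul_assoc, ← mul_assoc,
      ← mul_assoc, ← map_mul, ← map_mul, ← map_mul]
    congr 2
    simp [mul_comm, mul_left_comm]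
  generalize hσdef : (fun g => z (f g) * ρ g) = σ at *
  replace hσ : ∀ g h, σ g * σ h = z (β.1 g h) * σ (g * h) := by
    intro g h; rw [← hσdef]; exact hσ g h
  -- The coordinate in G keeps the projection well defined even when ρ is not faithful. As `Γ :
  -- Type`, `E` stays in the universe of `G`.
  let E := scalarExtension hc hσ hβn
  have hE : Finite E := by
    refine Finite.of_surjective
      (fun q : rootsOfUnity n ℂ × G => (⟨(z q.1 * σ q.2, q.2), q.1, q.1.2, rfl⟩ : E)) ?_
    rintro ⟨⟨x, g⟩, a, ha, hx⟩
    exact ⟨(⟨a, ha⟩, g), Subtype.ext (Prod.ext hx.symm rfl)⟩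
  let proj : E →* G := (MonoidHom.snd Γ G).comp E.subtype
  let s : G → E := fun g => ⟨(σ g, g), 1, one_pow n, by simp⟩
  let ι : rootsOfUnity n ℂ →* E :=
    { toFun := fun a => ⟨(z a, 1), a * (β.1 1 1)⁻¹, by
          rw [mul_pow, inv_pow, hβn, inv_one, mul_one]; exact a.2, by
          have h := hσ 1 1
          rw [one_mul] at h
          simp [mul_right_cancel h]⟩
      map_one' := by ext <;> simp
      map_mul' := fun a b => by ext <;> simp }
  have hι : Function.Injective ι := by
    intro a b h
    exact Subtype.ext (hz (congrArg (fun e : E => e.1.1) h))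
  have hrange : ι.range = proj.ker := by
    ext e
    constructor
    · rintro ⟨a, rfl⟩
      rfl
    · intro he
      obtain ⟨⟨x, g⟩, a, ha, hx⟩ := e
      obtain rfl : g = 1 := he
      have h := hσ 1 1
      rw [one_mul] at h
      dsimp only at hx
      rw [mul_right_cancel h, ← map_mul] at hx
      refine ⟨⟨a * β.1 1 1, ?_⟩, ?_⟩
      · rw [mem_rootsOfUnity, mul_pow, ha, hβn, one_mul]
      · exact Subtype.ext (Prod.ext hx.symm rfl)
  have hs : ∀ g h, s g * s h = ι ⟨β.1 g h, hβn g h⟩ * s (g * h) := by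
    intro g h
    refine Subtype.ext (Prod.ext (hσ g h) ?_)
    exact (one_mul _).symm
  have hcyc : IsCyclic (rootsOfUnity n ℂ) := inferInstance
  have eker : rootsOfUnity n ℂ ≃* proj.ker :=
    (MonoidHom.ofInjective hι).trans (MulEquiv.subgroupCongr hrange)
  refine ⟨{ E := E, proj := proj, proj_surjective := fun g => ⟨s g, rfl⟩
            ker_le_center := ?_, ker_le_commutator := ?_, ker_embeds := ?_ },
    (MonoidHom.fst Γ G).comp E.subtype, ?_, ?_⟩
  · rw [← hrange]
    rintro _ ⟨a, rfl⟩
    rw [Subgroup.mem_center_iff]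
    intro e
    refine Subtype.ext (Prod.ext (hc _ _).symm ?_)
    exact (mul_one _).trans (one_mul _).symm
  · rw [← hrange]
    rintro _ ⟨a, rfl⟩
    -- Otherwise a linear character ψ of `E` is nontrivial at ι a. On the cyclic group μₙ it is b ↦
    -- bᵏ, and ψ ∘ s exhibits βᵏ as a coboundary; hence n ∣ k and ψ (ι a) = 1.
    by_contra ha
    have hne : Abelianization.of (ι a) ≠ 1 := by
      rwa [Ne, ← MonoidHom.mem_ker, Abelianization.ker_of]
    have : NeZero (Monoid.exponent (Abelianization E)) := ⟨Monoid.exponent_ne_zero_of_finite⟩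
    obtain ⟨χ, hχ⟩ := CommGroup.exists_apply_ne_one_of_hasEnoughRootsOfUnity
      (Abelianization E) ℂ hne
    let ψ : E →* ℂˣ := χ.comp Abelianization.of
    have hψn : ∀ b, ψ (ι b) ∈ rootsOfUnity n ℂ := by
      intro b
      have hb : b ^ n = 1 := Subtype.ext b.2
      rw [mem_rootsOfUnity, ← map_pow, ← map_pow, hb, map_one, map_one]
    obtain ⟨k, hk⟩ := MonoidHom.map_cyclic ((ψ.comp ι).codRestrict (rootsOfUnity n ℂ) hψn)
    have hk' : ∀ b : rootsOfUnity n ℂ, ψ (ι b) = (b : ℂˣ) ^ k := fun b => by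
      simpa using congrArg Subtype.val (hk b)
    have hone : (QuotientGroup.mk β : SchurMultiplier G) ^ k = 1 := by
      rw [schurClass_zpow_eq_one_iff]
      refine ⟨fun g => ψ (s g), fun g h => ?_⟩
      rw [eq_mul_inv_iff_mul_eq, ← map_mul, hs, map_mul, hk']
    rw [← orderOf_dvd_iff_zpow_eq_one, ← hn] at hone
    obtain ⟨j, rfl⟩ := hone
    apply hχ
    change ψ (ι a) = 1
    rw [hk', zpow_mul, zpow_natCast, show (a : ℂˣ) ^ n = 1 from a.2, one_zpow]
  -- The kernel and the subgroup generated by the class of β are both cyclic of order n.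
  · have hcard : Nat.card proj.ker =
        Nat.card (Subgroup.zpowers (QuotientGroup.mk β : SchurMultiplier G)) := by
      rw [Nat.card_zpowers, ← hn, ← Nat.card_congr eker.toEquiv]
      exact HasEnoughRootsOfUnity.natCard_rootsOfUnity ℂ n
    have : IsCyclic proj.ker := isCyclic_of_surjective eker eker.surjective
    exact ⟨(Subgroup.subtype _).comp (mulEquivOfCyclicCardEq hcard).toMonoidHom,
      (Subgroup.subtype_injective _).comp (mulEquivOfCyclicCardEq hcard).injective⟩
  · rintro ⟨⟨x, g⟩, a, ha, hx⟩
    refine ⟨a * f g, hx.trans ?_⟩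
    rw [map_mul, mul_assoc]
    exact congrArg (z a * ·) (congrFun hσdef g).symm
  · rintro ⟨⟨x, g⟩, h⟩ h1 h2
    exact Subtype.ext (Prod.ext h1 h2)

end Extension

/-! ### Schur's lemma and invariant subspaces -/

section Irreducibility

/-- **Schur's lemma** for an irreducible family of operators. -/
theorem Module.End.exists_eq_smul_one_of_commute {V : Type v} [AddCommGroup V] [Module ℂ V]
    [FiniteDimensional ℂ V] {ι : Type u} (ρ : ι → Module.End ℂ V) (hV : Nontrivial V)
    (hρ : ∀ W : Submodule ℂ V, (∀ i, ∀ w ∈ W, ρ i w ∈ W) → W = ⊥ ∨ W = ⊤)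
    (T : Module.End ℂ V) (hT : ∀ i, T * ρ i = ρ i * T) : ∃ c : ℂ, T = c • 1 := by
  obtain ⟨c, hc⟩ := Module.End.exists_eigenvalue T
  refine ⟨c, ?_⟩
  have htop := (hρ (T.eigenspace c) fun i w hw => by
    rw [Module.End.mem_eigenspace_iff] at hw ⊢
    rw [← Module.End.mul_apply, hT, Module.End.mul_apply, hw, map_smul]).resolve_left hc
  ext1 w
  exact Module.End.mem_eigenspace_iff.1 (htop ▸ Submodule.mem_top : w ∈ T.eigenspace c)

/-- Puts ordinary irreducibility in the same form as `IsProjectivelyIrreducible`, so that the two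
can be compared subspace by subspace. -/
theorem Representation.isIrreducible_iff {H : Type u} [Group H] {V : Type v} [AddCommGroup V]
    [Module ℂ V] (φ : Representation ℂ H V) :
    φ.IsIrreducible ↔ Nontrivial V ∧
      ∀ W : Submodule ℂ V, (∀ g, ∀ w ∈ W, φ g w ∈ W) → W = ⊥ ∨ W = ⊤ := by
  have hbot : ∀ U : Subrepresentation φ, U = ⊥ ↔ U.toSubmodule = ⊥ := fun U =>
    Subrepresentation.toSubmodule_injective.eq_iff.symm
  have htop : ∀ U : Subrepresentation φ, U = ⊤ ↔ U.toSubmodule = ⊤ := fun U =>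
    Subrepresentation.toSubmodule_injective.eq_iff.symm
  constructor
  · intro h
    refine ⟨?_, fun W hW => ?_⟩
    · by_contra hV
      rw [not_nontrivial_iff_subsingleton] at hV
      exact bot_ne_top ((hbot (⊤ : Subrepresentation φ)).2 (Subsingleton.elim _ _)).symm
    · have := eq_bot_or_eq_top (⟨W, fun g w hw => hW g w hw⟩ : Subrepresentation φ)
      rwa [hbot, htop] at this
  · rintro ⟨hV, h⟩
    refine { exists_pair_ne := ⟨⊥, ⊤, ?_⟩, eq_bot_or_eq_top := fun U => ?_ }
    · intro hbt
      exact bot_ne_top ((htop (⊥ : Subrepresentation φ)).1 hbt)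
    · rw [hbot, htop]
      exact h _ fun g w hw => U.apply_mem_toSubmodule g hw

end Irreducibility

/-! ### Passing between projective and ordinary representations -/

section Lifting

/-- The scalar automorphisms of a complex vector space. -/
def scalarGL (V : Type v) [AddCommGroup V] [Module ℂ V] :
    ℂˣ →* LinearMap.GeneralLinearGroup ℂ V :=
  Units.map (algebraMap ℂ (Module.End ℂ V)).toMonoidHom

theorem coe_scalarGL {V : Type v} [AddCommGroup V] [Module ℂ V] (a : ℂˣ) :
    (scalarGL V a : Module.End ℂ V) = (a : ℂ) • 1 :=
  Algebra.algebraMap_eq_smul_one _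

theorem scalarGL_injective {V : Type v} [AddCommGroup V] [Module ℂ V] [Nontrivial V] :
    Function.Injective (scalarGL V) :=
  Units.map_injective (FaithfulSMul.algebraMap_injective ℂ (Module.End ℂ V))

theorem scalarGL_comm {V : Type v} [AddCommGroup V] [Module ℂ V] (a : ℂˣ)
    (x : LinearMap.GeneralLinearGroup ℂ V) : scalarGL V a * x = x * scalarGL V a :=
  Units.ext (Algebra.commutes _ _)

theorem coe_scalarGL_mul {V : Type v} [AddCommGroup V] [Module ℂ V] (a : ℂˣ)
    (x : LinearMap.GeneralLinearGroup ℂ V) :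
    ((scalarGL V a * x : LinearMap.GeneralLinearGroup ℂ V) : Module.End ℂ V) =
      (a : ℂ) • (x : Module.End ℂ V) := by
  rw [Units.val_mul, coe_scalarGL, smul_mul_assoc, one_mul]

variable {G : Type u} [Group G]

/-- A faithful projective representation lifts to a faithful representation of a covering; if it
is irreducible then so is the lift, and the kernel of the covering is the whole center. -/
theorem exists_covering_faithful_rep [Finite G] {d : ℕ} (hd : 0 < d)
    {ρ : G → LinearMap.GeneralLinearGroup ℂ (Fin d → ℂ)} (hρ : IsProjectiveRep ρ)
    (hf : IsProjectivelyFaithful ρ) :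
    ∃ (C : GroupCovering G) (φ : Representation ℂ C.E (Fin d → ℂ)), Function.Injective φ ∧
      (IsProjectivelyIrreducible ρ → φ.IsIrreducible ∧ C.proj.ker = Subgroup.center C.E) := by
  have : NeZero d := ⟨hd.ne'⟩
  obtain ⟨h1, α, hα⟩ := hρ
  obtain ⟨C, φ, hφ, hker⟩ := exists_covering_of_factorSet (scalarGL_injective)
    scalarGL_comm (ρ := ρ) (α := α)
    (fun g h => Units.ext (by rw [coe_scalarGL_mul, Units.val_mul, hα]))
  have hφ' : ∀ e, ∃ a : ℂˣ, (φ e : Module.End ℂ (Fin d → ℂ)) =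
      (a : ℂ) • (ρ (C.proj e) : Module.End ℂ (Fin d → ℂ)) := fun e => by
    obtain ⟨a, ha⟩ := hφ e
    exact ⟨a, by rw [ha, coe_scalarGL_mul]⟩
  have hscalar : ∀ e, ∀ c : ℂˣ, (φ e : Module.End ℂ (Fin d → ℂ)) = (c : ℂ) • 1 →
      C.proj e = 1 := by
    intro e c hc
    obtain ⟨a, ha⟩ := hφ' e
    refine hf _ ⟨a⁻¹ * c, ?_⟩
    rw [Units.val_mul, mul_smul, ← hc, ha, smul_smul, Units.inv_mul, one_smul]
  refine ⟨C, (Units.coeHom _).comp φ, ?_, fun hirr => ?_⟩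
  · refine (injective_iff_map_eq_one ((Units.coeHom _).comp φ)).2 fun e he => ?_
    have he' : φ e = 1 := Units.ext he
    exact hker e he' (hscalar e 1 (by rw [he']; simp))
  · have hsub : ∀ W : Submodule ℂ (Fin d → ℂ), (∀ e, ∀ w ∈ W,
        (φ e : Module.End ℂ (Fin d → ℂ)) w ∈ W) → W = ⊥ ∨ W = ⊤ := by
      intro W hW
      -- φ e and ρ (proj e) differ by a nonzero scalar, so they preserve the same subspaces.
      refine hirr.2 W fun g w hw => ?_
      obtain ⟨e, rfl⟩ := C.proj_surjective g
      obtain ⟨a, ha⟩ := hφ' e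
      have := hW e w hw
      rw [ha, LinearMap.smul_apply] at this
      exact (W.smul_mem_iff a.ne_zero).1 this
    refine ⟨(Representation.isIrreducible_iff _).2 ⟨hirr.1, hsub⟩,
      le_antisymm C.ker_le_center fun e he => ?_⟩
    obtain ⟨c, hc⟩ := Module.End.exists_eq_smul_one_of_commute
      (fun e => (φ e : Module.End ℂ (Fin d → ℂ))) hirr.1 hsub (φ e) fun e' => by
        rw [← Units.val_mul, ← Units.val_mul, ← map_mul, ← map_mul,
          Subgroup.mem_center_iff.1 he e']
    have hc0 : c ≠ 0 := by
      rintro rfl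
      rw [zero_smul] at hc
      exact (φ e).ne_zero hc
    exact hscalar e (Units.mk0 c hc0) hc

/-- A faithful irreducible representation of a central extension by the full center descends to a
faithful irreducible projective representation. -/
theorem exists_projectiveRep_of_isIrreducible {d : ℕ} (C : GroupCovering G)
    (hC : Nonempty (C.proj.ker ≃* Subgroup.center C.E)) (φ : Representation ℂ C.E (Fin d → ℂ))
    (hφ : Function.Injective φ) (hirr : φ.IsIrreducible) :
    ∃ ρ : G → LinearMap.GeneralLinearGroup ℂ (Fin d → ℂ),
      IsProjectiveRep ρ ∧ IsProjectivelyFaithful ρ ∧ IsProjectivelyIrreducible ρ := by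
  classical
  obtain ⟨hV, hW⟩ := (Representation.isIrreducible_iff φ).1 hirr
  -- The kernel lies in the center and has the same finite order, so an abstract isomorphism forces
  -- equality.
  have hker : C.proj.ker = Subgroup.center C.E :=
    Subgroup.eq_of_le_of_card_ge C.ker_le_center (Nat.card_congr hC.some.toEquiv).ge
  have hscalar : ∀ e ∈ C.proj.ker, ∃ c : ℂˣ, φ e = (c : ℂ) • 1 := by
    intro e he
    obtain ⟨c, hc⟩ := Module.End.exists_eq_smul_one_of_commute φ hV hW (φ e) fun e' => by
      rw [← map_mul, ← map_mul, Subgroup.mem_center_iff.1 (C.ker_le_center he) e']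
    have hc0 : c ≠ 0 := by
      rintro rfl
      have : (φ.toHomUnits e : Module.End ℂ (Fin d → ℂ)) = 0 := by
        rw [MonoidHom.coe_toHomUnits, hc, zero_smul]
      exact (φ.toHomUnits e).ne_zero this
    exact ⟨Units.mk0 c hc0, hc⟩
  obtain ⟨s, hs1, hs⟩ : ∃ s : G → C.E, s 1 = 1 ∧ ∀ g, C.proj (s g) = g := by
    choose s hs using C.proj_surjective
    refine ⟨Function.update s 1 1, by simp, fun g => ?_⟩
    by_cases hg : g = 1
    · simp [hg]
    · simp [hg, hs]
  refine ⟨fun g => φ.toHomUnits (s g), ⟨by simp [hs1], ?_⟩, ?_, hV, ?_⟩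
  · have : ∀ g h, ∃ c : ℂˣ, φ (s g) * φ (s h) = (c : ℂ) • φ (s (g * h)) := by
      intro g h
      obtain ⟨c, hc⟩ := hscalar (s g * s h * (s (g * h))⁻¹)
        (by rw [MonoidHom.mem_ker]; simp [hs])
      refine ⟨c, ?_⟩
      rw [← map_mul, ← one_mul (φ (s (g * h))), ← smul_mul_assoc, ← hc, ← map_mul,
        inv_mul_cancel_right]
    choose α hα using this
    exact ⟨α, hα⟩
  · rintro g ⟨c, hc⟩
    rw [MonoidHom.coe_toHomUnits] at hc
    -- A scalar commutes with every φ e, so injectivity of φ makes s g central, hence in the kernel.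
    have : s g ∈ Subgroup.center C.E := by
      rw [Subgroup.mem_center_iff]
      intro e
      apply hφ
      rw [map_mul, map_mul, hc, mul_smul_comm, smul_mul_assoc, one_mul, mul_one]
    rwa [← hker, MonoidHom.mem_ker, hs] at this
  · intro W hinv
    refine hW W fun e w hw => ?_
    obtain ⟨c, hc⟩ := hscalar (e * (s (C.proj e))⁻¹) (by rw [MonoidHom.mem_ker]; simp [hs])
    have : φ e = (c : ℂ) • φ (s (C.proj e)) := by
      rw [← one_mul (φ (s _)), ← smul_mul_assoc, ← hc, ← map_mul, inv_mul_cancel_right]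
    rw [this, LinearMap.smul_apply]
    exact W.smul_mem _ (hinv _ w hw)

/-- The regular representation is projectively faithful. -/
theorem exists_faithful_projectiveRep [Finite G] :
    ∃ ρ : G → LinearMap.GeneralLinearGroup ℂ (Fin (Nat.card G) → ℂ),
      IsProjectiveRep ρ ∧ IsProjectivelyFaithful ρ := by
  classical
  let e : G ≃ Fin (Nat.card G) := Finite.equivFin G
  let P : G →* LinearMap.GeneralLinearGroup ℂ (Fin (Nat.card G) → ℂ) :=
    { toFun := fun g => (LinearMap.GeneralLinearGroup.generalLinearEquiv ℂ _).symm
        (LinearEquiv.funCongrLeft ℂ ℂ ((e.symm.trans (Equiv.mulLeft g⁻¹)).trans e))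
      map_one' := by
        ext1
        refine LinearMap.ext fun v => funext fun i => ?_
        change v (e (1⁻¹ * e.symm i)) = v i
        simp
      map_mul' := fun g h => by
        ext1
        refine LinearMap.ext fun v => funext fun i => ?_
        change v (e ((g * h)⁻¹ * e.symm i)) = v (e (h⁻¹ * e.symm (e (g⁻¹ * e.symm i))))
        simp [mul_assoc] }
  refine ⟨P, ⟨map_one P, fun _ _ => 1, fun g h => by simp⟩, ?_⟩
  rintro g ⟨c, hc⟩
  by_contra hg
  -- g moves the basis vector at 1 to the one at g; for g ≠ 1 the coordinate at g would give 1 = c ·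
  -- 0.
  have h1 := congrFun (LinearMap.congr_fun hc (Pi.single (e 1) 1)) (e g)
  have h2 : (Pi.single (e 1) (1 : ℂ) : Fin (Nat.card G) → ℂ) (e (g⁻¹ * e.symm (e g))) =
      c * (Pi.single (e 1) (1 : ℂ) : Fin (Nat.card G) → ℂ) (e g) := h1
  simp [hg] at h2

end Lifting

/-! ### Comparison of the minimal degrees -/

theorem Nat.exists_isLeast_of_nonempty {S : Set ℕ} (hS : S.Nonempty) : ∃ n, IsLeast S n :=
  ⟨sInf S, Nat.sInf_mem hS, fun _ h => Nat.sInf_le h⟩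

theorem mainTheorem10 (G : Type u) [Group G] [Finite G] :
    ((∃ n : ℕ, IsIrrProjectiveEmbeddingDegree G n) ↔ (irrCoverings G).Nonempty) ∧
    ((irrCoverings G).Nonempty → ∃ n : ℕ, IsIrrProjectiveEmbeddingDegree G n ∧
      IsLeast {d : ℕ | ∃ C ∈ irrCoverings G, IsIrrEmbeddingDegree C.E d} n) ∧
    (∃ t m : ℕ, IsProjectiveEmbeddingDegree G t ∧
      IsLeast {d : ℕ | ∃ C : GroupCovering G, IsEmbeddingDegree C.E d} m ∧ m ≤ t) := by
  have lift : ∀ d : ℕ, (0 < d ∧ ∃ ρ : G → LinearMap.GeneralLinearGroup ℂ (Fin d → ℂ),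
      IsProjectiveRep ρ ∧ IsProjectivelyFaithful ρ ∧ IsProjectivelyIrreducible ρ) →
      ∃ C ∈ irrCoverings G, ∃ k ≤ d, IsIrrEmbeddingDegree C.E k := by
    rintro d ⟨hd, ρ, hρ, hf, hirr⟩
    obtain ⟨C, φ, hφ, h⟩ := exists_covering_faithful_rep hd hρ hf
    obtain ⟨hφi, hker⟩ := h hirr
    obtain ⟨k, hk⟩ := Nat.exists_isLeast_of_nonempty
      (⟨d, hd, φ, hφ, hφi⟩ : {d : ℕ | 0 < d ∧ ∃ ρ : Representation ℂ C.E (Fin d → ℂ),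
        Function.Injective ρ ∧ ρ.IsIrreducible}.Nonempty)
    exact ⟨C, ⟨⟨MulEquiv.subgroupCongr hker⟩, k, hk⟩, k, hk.2 ⟨hd, φ, hφ, hφi⟩, hk⟩
  have descend : ∀ C ∈ irrCoverings G, ∀ d, IsIrrEmbeddingDegree C.E d →
      0 < d ∧ ∃ ρ : G → LinearMap.GeneralLinearGroup ℂ (Fin d → ℂ),
        IsProjectiveRep ρ ∧ IsProjectivelyFaithful ρ ∧ IsProjectivelyIrreducible ρ := by
    rintro C ⟨hC, -⟩ d ⟨⟨hd, φ, hφ, hφi⟩, -⟩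
    exact ⟨hd, exists_projectiveRep_of_isIrreducible C hC φ hφ hφi⟩
  have main : (irrCoverings G).Nonempty → ∃ n : ℕ, IsIrrProjectiveEmbeddingDegree G n ∧
      IsLeast {d : ℕ | ∃ C ∈ irrCoverings G, IsIrrEmbeddingDegree C.E d} n := by
    rintro ⟨C, hC⟩
    obtain ⟨d, hd⟩ := hC.2
    obtain ⟨n, hn⟩ := Nat.exists_isLeast_of_nonempty
      (⟨d, C, hC, hd⟩ : {d : ℕ | ∃ C ∈ irrCoverings G, IsIrrEmbeddingDegree C.E d}.Nonempty)
    refine ⟨n, ⟨?_, fun t ht => ?_⟩, hn⟩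
    · obtain ⟨C', hC', hd'⟩ := hn.1
      exact descend C' hC' n hd'
    · obtain ⟨C', hC', k, hkt, hk⟩ := lift t ht
      exact (hn.2 ⟨C', hC', hk⟩).trans hkt
  refine ⟨⟨fun ⟨n, hn⟩ => ?_, fun h => (main h).imp fun _ => And.left⟩, main, ?_⟩
  · obtain ⟨C, hC, -⟩ := lift n hn.1
    exact ⟨C, hC⟩
  · obtain ⟨t, ht⟩ := Nat.exists_isLeast_of_nonempty
      (⟨Nat.card G, Nat.card_pos, exists_faithful_projectiveRep⟩ :
        {d : ℕ | 0 < d ∧ ∃ ρ : G → LinearMap.GeneralLinearGroup ℂ (Fin d → ℂ),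
          IsProjectiveRep ρ ∧ IsProjectivelyFaithful ρ}.Nonempty)
    obtain ⟨htpos, ρ, hρ, hf⟩ := ht.1
    obtain ⟨C, φ, hφ, -⟩ := exists_covering_faithful_rep htpos hρ hf
    obtain ⟨k, hk⟩ := Nat.exists_isLeast_of_nonempty
      (⟨t, htpos, φ, hφ⟩ : {d : ℕ | 0 < d ∧ ∃ ρ : Representation ℂ C.E (Fin d → ℂ),
        Function.Injective ρ}.Nonempty)
    obtain ⟨m, hm⟩ := Nat.exists_isLeast_of_nonempty
      (⟨k, C, hk⟩ : {d : ℕ | ∃ C : GroupCovering G, IsEmbeddingDegree C.E d}.Nonempty)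
    exact ⟨t, m, ht, hm, (hm.2 ⟨C, hk⟩).trans (hk.2 ⟨htpos, φ, hφ⟩)⟩
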